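/- Let $d \ge 1$ and let $\mu$ be a nonnegative Radon measure on $\mathbb{R}^d\setminus\{0\}$ that is symmetric, i.e. $\mu(B)=\mu(-B)$ for every Borel set $B$, and satisfies $\int (|z|^2\wedge 1)\,d\mu(z)<\infty$. Its support is $$\operatorname{supp}(\mu)=\{z\in\mathbb{R}^d\setminus\{0\} : \mu(B_r(z))>0 \text{ for all } r>0\}.$$ For $\psi\in C_c^\infty(\mathbb{R}^d)$ put $$\mathcal{L}^\mu[\psi](x)=\lim_{r\to 0^+}\int_{|z|>r}\big(\psi(x+z)-\psi(x)\big)\,d\mu(z),$$ and for $u\in L^\infty(\mathbb{R}^d)$ say that $\mathcal{L}^\mu[u]=0$ in $\mathcal{D}'(\mathbb{R}^d)$ if $\int_{\mathbb{R}^d}u\,\mathcal{L}^\mu[\psi]\,dx=0$ for all $\psi\in C_c^\infty(\mathbb{R}^d)$. All functions are real-valued. A relative lattice is a subgroup of $\mathbb{R}^d$ generated by a basis of some vector subspace of $\mathbb{R}^d$ (the subgroup $\{0\}$ is included). Then the following statements are equivalent: (a) If $u\in L^\infty(\mathbb{R}^d)$ satisfies $\mathcal{L}^\mu[u]=0$ in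 $\mathcal{D}'(\mathbb{R}^d)$, then $u$ is constant (almost everywhere). (b) The additive subgroup generated by $\operatorname{supp}(\mu)$ is dense in $\mathbb{R}^d$. (c) For every vector subspace $V\subseteq\mathbb{R}^d$ of dimension at most $d-1$ and every relative lattice $\Lambda\subseteq\mathbb{R}^d$ such that $V\cap\operatorname{Span}_{\mathbb{R}}\Lambda=\{0\}$, one has $\operatorname{supp}(\mu)\not\subseteq V\oplus\Lambda$. (d) For every vector subspace $H\subseteq\mathbb{R}^d$ of dimension $d-1$ and every $c\in\mathbb{R}^d$, one has $\operatorname{supp}(\mu)\not\subseteq H+c\mathbb{Z}$. -/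

import Mathlib

open MeasureTheory Filter Topology Set
open scoped Pointwise ContDiff

noncomputable section

/-- `ℝ^d` with its Euclidean norm. -/
abbrev Rd (d : ℕ) : Type := EuclideanSpace ℝ (Fin d)

/-- A symmetric Lévy measure. A Borel measure on `ℝ^d \ {0}` is represented by a Borel measure on
`ℝ^d` that does not charge the origin. Integrability of `|z|² ∧ 1` makes the measure finite on the
compact subsets of `ℝ^d \ {0}`, that is, Radon there. -/
structure IsSymmetricLevyMeasure {d : ℕ} (μ : Measure (Rd d)) : Prop where
  zero_singleton : μ {0} = 0
  symmetric : ∀ B : Set (Rd d), MeasurableSet B → μ B = μ (-B)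
  lintegral_lt_top : ∫⁻ z, ENNReal.ofReal (min (‖z‖ ^ 2) 1) ∂μ < (⊤ : ENNReal)

/-- The support of `μ` as a measure on `ℝ^d \ {0}`; it never contains the origin. -/
def levySupport {d : ℕ} (μ : Measure (Rd d)) : Set (Rd d) :=
  {z | z ≠ 0 ∧ ∀ r : ℝ, 0 < r → 0 < μ (Metric.ball z r)}

/-- The truncated operator `∫_{|z| > r} (ψ(x+z) - ψ(x)) dμ(z)`. -/
def truncatedLevyOperator {d : ℕ} (μ : Measure (Rd d)) (r : ℝ) (ψ : Rd d → ℝ) (x : Rd d) : ℝ :=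
  ∫ z in {z : Rd d | r < ‖z‖}, (ψ (x + z) - ψ x) ∂μ

/-- The operator `L^μ[ψ](x) = P.V. ∫ (ψ(x+z) - ψ(x)) dμ(z)`, the principal value being the limit of
the truncated operators as `r → 0+`. The limit exists for every test function when `μ` is a
symmetric Lévy measure, see `tendsto_truncatedLevyOperator`. -/
def levyOperator {d : ℕ} (μ : Measure (Rd d)) (ψ : Rd d → ℝ) (x : Rd d) : ℝ :=
  limUnder (𝓝[>] (0 : ℝ)) (fun r => truncatedLevyOperator μ r ψ x)

/-- `L^μ[u] = 0` in the sense of distributions: `∫ u L^μ[ψ] dx = 0` for all real-valued `ψ` that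
are smooth with compact support. -/
def IsDistributionalSolution {d : ℕ} (μ : Measure (Rd d)) (u : Rd d → ℝ) : Prop :=
  ∀ ψ : Rd d → ℝ, ContDiff ℝ ∞ ψ → HasCompactSupport ψ →
    ∫ x, u x * levyOperator μ ψ x = 0

/-- A relative lattice: a subgroup generated by a basis of some vector subspace, that is, by a
finite linearly independent family. The empty family gives the trivial lattice `{0}`. -/
def IsRelativeLattice {d : ℕ} (Λ : AddSubgroup (Rd d)) : Prop :=
  ∃ (k : ℕ) (a : Fin k → Rd d), LinearIndependent ℝ a ∧ Λ = AddSubgroup.closure (range a)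

/-- Second-order Taylor bound for second differences of test functions. -/
theorem exists_bound_second_difference {d : ℕ} {ψ : Rd d → ℝ} (hψ : ContDiff ℝ ∞ ψ)
    (hc : HasCompactSupport ψ) :
    ∃ C : ℝ, ∀ x z, |ψ (x + z) + ψ (x - z) - 2 * ψ x| ≤ C * min (‖z‖ ^ 2) 1 := by
  have hd : ContDiff ℝ 1 (fderiv ℝ ψ) := hψ.fderiv_right (by norm_cast)
  obtain ⟨L, hL⟩ := hd.lipschitzWith_of_hasCompactSupport (hc.fderiv ℝ) one_ne_zero
  obtain ⟨M, hM⟩ := hc.exists_bound_of_continuous hψ.continuous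
  have hM0 : 0 ≤ M := (norm_nonneg _).trans (hM 0)
  have key : ∀ x z, |ψ (x + z) - ψ x - fderiv ℝ ψ x z| ≤ L * ‖z‖ * ‖z‖ := by
    intro x z
    have h := (convex_closedBall x ‖z‖).norm_image_sub_le_of_norm_hasFDerivWithin_le'
      (𝕜 := ℝ) (f := ψ) (f' := fderiv ℝ ψ) (φ := fderiv ℝ ψ x) (C := L * ‖z‖) (x := x) (y := x + z)
      (fun y _ => ((hψ.differentiable (by simp)) y).hasFDerivAt.hasFDerivWithinAt)
      (fun y hy => by
        have h1 := hL.dist_le_mul y x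
        rw [dist_eq_norm] at h1
        exact h1.trans (mul_le_mul_of_nonneg_left (Metric.mem_closedBall.1 hy) L.2))
      (Metric.mem_closedBall_self (norm_nonneg z)) (by simp)
    simpa using h
  refine ⟨2 * L + 4 * M, fun x z => ?_⟩
  have hL0 : (0 : ℝ) ≤ L := L.2
  rcases le_total (‖z‖ ^ 2) 1 with h | h
  · rw [min_eq_left h]
    have h1 := abs_le.1 (key x z)
    have h2 := key x (-z)
    rw [map_neg, norm_neg, ← sub_eq_add_neg] at h2
    have h2 := abs_le.1 h2
    have : 0 ≤ M * ‖z‖ ^ 2 := by positivity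
    rw [abs_le]
    constructor <;> nlinarith [h1.1, h1.2, h2.1, h2.2]
  · rw [min_eq_right h]
    have h1 := abs_le.1 (hM (x + z))
    have h2 := abs_le.1 (hM (x - z))
    have h3 := abs_le.1 (hM x)
    rw [abs_le]
    constructor <;> linarith [h1.1, h1.2, h2.1, h2.2, h3.1, h3.2]

/-- The principal value defining `L^μ[ψ](x)` exists for every test function. -/
theorem tendsto_truncatedLevyOperator {d : ℕ} {μ : Measure (Rd d)} (hμ : IsSymmetricLevyMeasure μ)
    {ψ : Rd d → ℝ} (hψ : ContDiff ℝ ∞ ψ) (hc : HasCompactSupport ψ) (x : Rd d) :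
    Tendsto (fun r => truncatedLevyOperator μ r ψ x) (𝓝[>] (0 : ℝ)) (𝓝 (levyOperator μ ψ x)) := by
  obtain ⟨C, hC⟩ := exists_bound_second_difference hψ hc
  have hψc := hψ.continuous
  have hneg : MeasurePreserving (fun z : Rd d => -z) μ μ := by
    refine ⟨measurable_neg, Measure.ext fun B hB => ?_⟩
    rw [Measure.map_apply measurable_neg hB]
    exact (hμ.symmetric B hB).symm
  have hmin : Integrable (fun z : Rd d => min (‖z‖ ^ 2) 1) μ := by
    refine ⟨by fun_prop, ?_⟩
    rw [hasFiniteIntegral_iff_ofReal (Eventually.of_forall fun z => by positivity)]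
    exact hμ.lintegral_lt_top
  have hmeas : ∀ r : ℝ, MeasurableSet {z : Rd d | r < ‖z‖} :=
    fun r => measurableSet_lt measurable_const measurable_norm
  have hfin : ∀ r : ℝ, 0 < r → μ {z : Rd d | r < ‖z‖} < ⊤ := by
    intro r hr
    refine (measure_mono ?_).trans_lt
      (hmin.measure_ge_lt_top (ε := min (r ^ 2) 1) (by positivity))
    intro z hz
    have hz : r < ‖z‖ := hz
    exact min_le_min_right 1 (pow_le_pow_left₀ hr.le hz.le 2)
  obtain ⟨M, hM⟩ := hc.exists_bound_of_continuous hψc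
  have hint : ∀ r : ℝ, 0 < r → ∀ s : Rd d → Rd d, Continuous s →
      IntegrableOn (fun z => ψ (s z) - ψ x) {z : Rd d | r < ‖z‖} μ := by
    intro r hr s hs
    refine Measure.integrableOn_of_bounded (M := M + M) (hfin r hr).ne
      (by fun_prop) (Eventually.of_forall fun z => ?_)
    exact (norm_sub_le _ _).trans (add_le_add (hM _) (hM _))
  have hsymm : ∀ r : ℝ, 0 < r → truncatedLevyOperator μ r ψ x =
      ∫ z, {z : Rd d | r < ‖z‖}.indicator
        (fun z => (ψ (x + z) + ψ (x - z) - 2 * ψ x) / 2) z ∂μ := by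
    intro r hr
    have h1 : ∫ z in {z : Rd d | r < ‖z‖}, (ψ (x - z) - ψ x) ∂μ =
        truncatedLevyOperator μ r ψ x := by
      have := hneg.setIntegral_preimage_emb (MeasurableEquiv.neg (Rd d)).measurableEmbedding
        (fun z => ψ (x + z) - ψ x) {z : Rd d | r < ‖z‖}
      simpa [truncatedLevyOperator, sub_eq_add_neg] using this
    rw [integral_indicator (hmeas r)]
    have h2 := integral_add (hint r hr (fun z => x + z) (by fun_prop))
      (hint r hr (fun z => x - z) (by fun_prop))
    rw [h1] at h2
    have h3 : (fun z => (ψ (x + z) + ψ (x - z) - 2 * ψ x) / 2) =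
        fun z => ((ψ (x + z) - ψ x) + (ψ (x - z) - ψ x)) / 2 := by
      funext z; ring
    rw [h3, integral_div, h2]
    unfold truncatedLevyOperator
    ring
  refine tendsto_nhds_limUnder ⟨∫ z, (ψ (x + z) + ψ (x - z) - 2 * ψ x) / 2 ∂μ, ?_⟩
  refine Tendsto.congr' (f₁ := fun r => ∫ z, {z : Rd d | r < ‖z‖}.indicator
    (fun z => (ψ (x + z) + ψ (x - z) - 2 * ψ x) / 2) z ∂μ) ?_ ?_
  · filter_upwards [self_mem_nhdsWithin] with r hr using (hsymm r hr).symm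
  · refine tendsto_integral_filter_of_dominated_convergence
      (fun z => C / 2 * min (‖z‖ ^ 2) 1) ?_ ?_ (hmin.const_mul _) ?_
    · refine Eventually.of_forall fun r => ?_
      exact (Continuous.aestronglyMeasurable (by fun_prop)).indicator (hmeas r)
    · refine Eventually.of_forall fun r => Eventually.of_forall fun z => ?_
      refine (norm_indicator_le_norm_self _ _).trans ?_
      rw [Real.norm_eq_abs, abs_div, abs_two]
      linarith [hC x z]
    · refine Eventually.of_forall fun z => ?_
      by_cases hz : z = 0
      · subst hz
        have h0 : ψ x + ψ x - 2 * ψ x = 0 := by ring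
        refine tendsto_const_nhds.congr' (Eventually.of_forall fun r => ?_)
        simp [indicator, h0]
      · refine tendsto_const_nhds.congr' ?_
        have hz' : 0 < ‖z‖ := norm_pos_iff.2 hz
        filter_upwards [nhdsWithin_le_nhds (Iio_mem_nhds hz')] with r hr
        rw [indicator_of_mem]
        exact hr

end

/-!
The four statements fail together, exactly when some nonzero linear functional `f` takes integer
values on the support of `μ`.

From such an `f` the bounded function `cos (2π f)` is nonconstant and periodic along the support,
hence a distributional solution (`exists_nonconstant_solution`). Any `V ⊕ Λ` with `V` proper carries
such an `f` (`exists_integer_functional`), and the points where `f` is an integer lie in some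
`H + c ℤ` (`exists_hyperplane_of_integer_functional`).

If the closed subgroup `G` generated by the support is proper, it is itself some `V ⊕ Λ`: with `V`
the largest subspace in `G`, the group `G ∩ Vᗮ` is closed and contains no line, so it is discrete
(`exists_eq_submodule_add_relativeLattice`).

If the support generates a dense subgroup, the Liouville property holds. Mollifications `w` of a
bounded distributional solution are uniformly continuous classical solutions
(`IsDistributionalSolution.isBoundedClassicalSolution`), by Fubini's theorem and an `L¹` Taylor bound
for second differences. For `z` in the support, the increment `v = w(· + z) - w` is again such a
solution. By a quantitative maximum principle
(`IsBoundedClassicalSolution.almost_maximum_translate`), where `v` is nearly equal to its supremum it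
is still so after translation by `z`, so a positive supremum would make `w` grow linearly along
multiples of `z`, against its boundedness. Hence `w` is periodic along the support, thus constant,
and letting the mollifier shrink gives that the solution is constant almost everywhere.
-/

/-! ### Closed subgroups of a Euclidean space and integer-valued functionals -/

section ClosedSubgroups

variable {E : Type*} [NormedAddCommGroup E] [NormedSpace ℝ E]

/-- The largest vector subspace contained in an additive subgroup: the vectors whose whole line
lies in the subgroup. -/
def AddSubgroup.linealitySpace (G : AddSubgroup E) : Submodule ℝ E where
  carrier := {v | ∀ t : ℝ, t • v ∈ G}
  add_mem' := fun ha hb t => by rw [smul_add]; exact G.add_mem (ha t) (hb t)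
  zero_mem' := fun t => by rw [smul_zero]; exact G.zero_mem
  smul_mem' := fun c v hv t => by rw [smul_smul]; exact hv _

theorem AddSubgroup.linealitySpace_le {G : AddSubgroup E} {v : E} (hv : v ∈ G.linealitySpace) :
    v ∈ G := by
  simpa using hv 1

/-- Arbitrarily short nonzero elements of a closed subgroup accumulate, after normalization, at a
direction whose line lies in the subgroup, because the integer multiples of the short elements
follow that line more and more closely. -/
theorem AddSubgroup.linealitySpace_ne_bot [FiniteDimensional ℝ E] {G : AddSubgroup E}
    (hG : IsClosed (G : Set E)) (h : ∀ ε > 0, ∃ g ∈ G, g ≠ 0 ∧ ‖g‖ < ε) :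
    G.linealitySpace ≠ ⊥ := by
  have : ProperSpace E := FiniteDimensional.proper ℝ E
  choose g hgG hg0 hgn using fun n : ℕ => h (1 / ((n : ℝ) + 1)) Nat.one_div_pos_of_nat
  have hpos : ∀ n, 0 < ‖g n‖ := fun n => norm_pos_iff.2 (hg0 n)
  have hlim : Tendsto (fun n => ‖g n‖) atTop (𝓝 0) :=
    squeeze_zero (fun n => norm_nonneg _) (fun n => (hgn n).le)
      tendsto_one_div_add_atTop_nhds_zero_nat
  obtain ⟨v, hv, φ, hφ, hφv⟩ := (isCompact_sphere (0 : E) 1).tendsto_subseq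
    (x := fun n => ‖g n‖⁻¹ • g n) (fun n => by simp [norm_smul, (hpos n).ne'])
  have hvmem : v ∈ G.linealitySpace := by
    intro t
    have hfl : Tendsto (fun n => (⌊t / ‖g (φ n)‖⌋ : ℝ) * ‖g (φ n)‖) atTop (𝓝 t) := by
      have hl := hlim.comp hφ.tendsto_atTop
      refine tendsto_of_tendsto_of_tendsto_of_le_of_le (g := fun n => t - ‖g (φ n)‖)
        (h := fun _ => t) (by simpa using hl.const_sub t) tendsto_const_nhds ?_ ?_
      · intro n
        have h1 := Int.sub_one_lt_floor (t / ‖g (φ n)‖)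
        have h2 := mul_lt_mul_of_pos_right h1 (hpos (φ n))
        rw [sub_mul, div_mul_cancel₀ _ (hpos _).ne'] at h2
        simpa using h2.le
      · intro n
        have h2 := mul_le_mul_of_nonneg_right (Int.floor_le (t / ‖g (φ n)‖)) (hpos (φ n)).le
        rwa [div_mul_cancel₀ _ (hpos _).ne'] at h2
    refine hG.mem_of_tendsto (hfl.smul hφv) (Eventually.of_forall fun n => ?_)
    have : ((⌊t / ‖g (φ n)‖⌋ : ℝ) * ‖g (φ n)‖) • (‖g (φ n)‖⁻¹ • g (φ n)) =
        ⌊t / ‖g (φ n)‖⌋ • g (φ n) := by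
      rw [smul_smul, mul_assoc, mul_inv_cancel₀ (hpos _).ne', mul_one, Int.cast_smul_eq_zsmul]
    simp only [Function.comp_apply, this]
    exact G.zsmul_mem (hgG _) _
  intro hbot
  rw [hbot, Submodule.mem_bot] at hvmem
  simp [hvmem] at hv

/-- A closed subgroup that contains no line is discrete. -/
theorem AddSubgroup.discreteTopology_of_linealitySpace_eq_bot [FiniteDimensional ℝ E]
    {G : AddSubgroup E} (hG : IsClosed (G : Set E)) (h : G.linealitySpace = ⊥) :
    DiscreteTopology G := by
  refine discreteTopology_of_isOpen_singleton_zero ?_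
  by_contra hno
  refine AddSubgroup.linealitySpace_ne_bot hG (fun ε hε => ?_) h
  by_contra! hε'
  refine hno (Metric.isOpen_singleton_iff.2 ⟨ε, hε, fun y hy => ?_⟩)
  by_contra hy0
  have := hε' y y.2 (by simpa using hy0)
  rw [dist_zero_right] at hy
  exact absurd hy (not_lt.2 this)

end ClosedSubgroups

/-- A discrete subgroup is a relative lattice. -/
theorem isRelativeLattice_of_discreteTopology {d : ℕ} (Λ : AddSubgroup (Rd d))
    [hΛ : DiscreteTopology Λ] : IsRelativeLattice Λ := by
  let L : Submodule ℤ (Rd d) := AddSubgroup.toIntSubmodule Λ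
  have hL : DiscreteTopology L := hΛ
  let b := Module.finBasis ℤ L
  let a : Fin (Module.finrank ℤ L) → Rd d := fun i => b i
  have hspan : Submodule.span ℤ (range a) = L := by
    have : range a = L.subtype '' range b := by
      rw [← range_comp]; rfl
    rw [this, ← Submodule.map_span, b.span_eq, Submodule.map_top, Submodule.range_subtype]
  refine ⟨_, a, ?_, ?_⟩
  · rw [linearIndependent_iff_card_eq_finrank_span, Fintype.card_fin]
    have hd : DiscreteTopology (Submodule.span ℤ (range a)) := by rwa [hspan]
    rw [Real.finrank_eq_int_finrank_of_discrete hd, Set.finrank, hspan]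
  · ext x
    rw [← Submodule.span_int_eq_addSubgroupClosure, hspan]
    rfl

/-- A closed subgroup splits as the sum of its lineality space `V` and its intersection with `Vᗮ`.
The latter is closed and contains no line, hence is a relative lattice. -/
theorem exists_eq_submodule_add_relativeLattice {d : ℕ} {G : AddSubgroup (Rd d)}
    (hG : IsClosed (G : Set (Rd d))) :
    ∃ (V : Submodule ℝ (Rd d)) (Λ : AddSubgroup (Rd d)), IsRelativeLattice Λ ∧
      V ⊓ Submodule.span ℝ (Λ : Set (Rd d)) = ⊥ ∧
      (G : Set (Rd d)) = (V : Set (Rd d)) + (Λ : Set (Rd d)) := by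
  let V := G.linealitySpace
  let Λ : AddSubgroup (Rd d) := G ⊓ Vᗮ.toAddSubgroup
  have hΛc : IsClosed (Λ : Set (Rd d)) := hG.inter (Submodule.isClosed_orthogonal V)
  have hspan : Submodule.span ℝ (Λ : Set (Rd d)) ≤ Vᗮ := Submodule.span_le.2 fun x hx => hx.2
  have hΛ : DiscreteTopology Λ := by
    refine AddSubgroup.discreteTopology_of_linealitySpace_eq_bot hΛc ?_
    rw [eq_bot_iff, ← V.inf_orthogonal_eq_bot]
    intro v hv
    exact ⟨fun t => (hv t).1, (AddSubgroup.linealitySpace_le hv).2⟩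
  refine ⟨V, Λ, isRelativeLattice_of_discreteTopology Λ, ?_, ?_⟩
  · rw [eq_bot_iff, ← V.inf_orthogonal_eq_bot]
    exact inf_le_inf_left V hspan
  · ext x
    rw [Set.mem_add]
    constructor
    · intro hx
      have h1 : V.starProjection x ∈ V := V.starProjection_apply_mem x
      refine ⟨V.starProjection x, h1, x - V.starProjection x, ⟨?_, ?_⟩, by simp⟩
      · exact G.sub_mem hx (AddSubgroup.linealitySpace_le h1)
      · exact V.sub_starProjection_mem_orthogonal x
    · rintro ⟨v, hv, l, hl, rfl⟩
      exact G.add_mem (AddSubgroup.linealitySpace_le hv) hl.1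

/-- On a proper subspace plus an independent relative lattice there is a nonzero functional with
integer values: it annihilates the subspace and all generators of the lattice but the first. -/
theorem exists_integer_functional {d : ℕ} {V : Submodule ℝ (Rd d)} {Λ : AddSubgroup (Rd d)}
    (hV : V ≠ ⊤) (hΛ : IsRelativeLattice Λ)
    (hVΛ : V ⊓ Submodule.span ℝ (Λ : Set (Rd d)) = ⊥) :
    ∃ f : Rd d →ₗ[ℝ] ℝ, f ≠ 0 ∧
      ∀ z ∈ (V : Set (Rd d)) + (Λ : Set (Rd d)), ∃ n : ℤ, f z = n := by
  obtain ⟨k, a, ha, rfl⟩ := hΛ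
  suffices h : ∃ f : Rd d →ₗ[ℝ] ℝ, f ≠ 0 ∧ (∀ v ∈ V, f v = 0) ∧ ∀ i, ∃ n : ℤ, f (a i) = n by
    obtain ⟨f, hf0, hfV, hfa⟩ := h
    refine ⟨f, hf0, ?_⟩
    have hle : AddSubgroup.closure (range a) ≤
        (Int.castAddHom ℝ).range.comap f.toAddMonoidHom := by
      rw [AddSubgroup.closure_le]
      rintro _ ⟨i, rfl⟩
      obtain ⟨n, hn⟩ := hfa i
      exact ⟨n, hn.symm⟩
    rintro _ ⟨v, hv, l, hl, rfl⟩
    obtain ⟨n, hn⟩ := hle hl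
    exact ⟨n, by simpa [hfV v hv] using hn.symm⟩
  cases k with
  | zero =>
    obtain ⟨f, hf, hfV⟩ := Submodule.exists_le_ker_of_lt_top V (lt_top_iff_ne_top.2 hV)
    exact ⟨f, hf, fun v hv => hfV hv, fun i => i.elim0⟩
  | succ k =>
    have hnot : a 0 ∉ V ⊔ Submodule.span ℝ (a '' {i | i ≠ 0}) := by
      intro hmem
      obtain ⟨v, hv, s, hs, hvs⟩ := Submodule.mem_sup.1 hmem
      have hsub : Submodule.span ℝ (a '' {i | i ≠ 0}) ≤
          Submodule.span ℝ (AddSubgroup.closure (range a) : Set (Rd d)) :=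
        Submodule.span_mono ((image_subset_range _ _).trans AddSubgroup.subset_closure)
      have hv' : v ∈ Submodule.span ℝ (AddSubgroup.closure (range a) : Set (Rd d)) := by
        rw [eq_sub_of_add_eq hvs]
        exact sub_mem (Submodule.subset_span (AddSubgroup.subset_closure (mem_range_self 0)))
          (hsub hs)
      have hv0 : v ∈ (⊥ : Submodule ℝ (Rd d)) := hVΛ ▸ ⟨hv, hv'⟩
      rw [Submodule.mem_bot] at hv0
      rw [hv0, zero_add] at hvs
      exact ha.notMem_span_image (s := {i | i ≠ 0}) (x := 0) (by simp) (hvs ▸ hs)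
    obtain ⟨f, hf, hle⟩ := Submodule.exists_le_ker_of_notMem hnot
    refine ⟨(f (a 0))⁻¹ • f, ?_, fun v hv => ?_, fun i => ?_⟩
    · intro h0
      simpa [hf] using congrArg (fun g : Rd d →ₗ[ℝ] ℝ => g (a 0)) h0
    · have : f v = 0 := hle (Submodule.mem_sup_left hv)
      simp [this]
    · by_cases hi : i = 0
      · exact ⟨1, by simp [hi, hf]⟩
      · have : f (a i) = 0 := hle (Submodule.mem_sup_right
          (Submodule.subset_span (mem_image_of_mem a hi)))
        exact ⟨0, by simp [this]⟩

/-- The level sets `f ∈ ℤ` of a nonzero functional lie in a set of the form `H + c ℤ`. -/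
theorem exists_hyperplane_of_integer_functional {d : ℕ} {f : Rd d →ₗ[ℝ] ℝ} (hf : f ≠ 0) :
    ∃ (H : Submodule ℝ (Rd d)) (c : Rd d), Module.finrank ℝ H = d - 1 ∧
      {z | ∃ n : ℤ, f z = n} ⊆ {z | ∃ h ∈ H, ∃ n : ℤ, z = h + n • c} := by
  obtain ⟨c, hc⟩ := LinearMap.surjective hf 1
  refine ⟨LinearMap.ker f, c, ?_, ?_⟩
  · have := Module.Dual.finrank_ker_add_one_of_ne_zero hf
    rw [finrank_euclideanSpace_fin] at this
    omega
  · rintro z ⟨n, hn⟩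
    exact ⟨z - n • c, by simp [hn, hc], n, by simp⟩

/-- If `c` already lies in `H`, the translates `H + n c` collapse and the lattice is trivial. -/
theorem exists_relativeLattice_of_hyperplane {d : ℕ} (H : Submodule ℝ (Rd d)) (c : Rd d) :
    ∃ Λ : AddSubgroup (Rd d), IsRelativeLattice Λ ∧
      H ⊓ Submodule.span ℝ (Λ : Set (Rd d)) = ⊥ ∧
      {z | ∃ h ∈ H, ∃ n : ℤ, z = h + n • c} ⊆ (H : Set (Rd d)) + (Λ : Set (Rd d)) := by
  by_cases hc : c ∈ H
  · refine ⟨⊥, ⟨0, Fin.elim0, linearIndependent_empty_type, by simp⟩, by simp, ?_⟩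
    rintro _ ⟨h, hh, n, rfl⟩
    exact ⟨h + n • c, H.add_mem hh (zsmul_mem hc n), 0, by simp, by simp⟩
  · have hc0 : c ≠ 0 := fun h => hc (h ▸ H.zero_mem)
    refine ⟨AddSubgroup.zmultiples c, ⟨1, fun _ => c, ?_, ?_⟩, ?_, ?_⟩
    · exact LinearIndependent.of_subsingleton 0 hc0
    · rw [AddSubgroup.zmultiples_eq_closure, range_const]
    · rw [eq_bot_iff]
      rintro x ⟨hxH, hx⟩
      have hle : Submodule.span ℝ (AddSubgroup.zmultiples c : Set (Rd d)) ≤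
          Submodule.span ℝ {c} := by
        rw [Submodule.span_le]
        rintro _ ⟨n, rfl⟩
        exact zsmul_mem (Submodule.mem_span_singleton_self c) n
      obtain ⟨t, rfl⟩ := Submodule.mem_span_singleton.1 (hle hx)
      by_cases ht : t = 0
      · simp [ht]
      · exact absurd ((H.smul_mem_iff ht).1 hxH) hc
    · rintro _ ⟨h, hh, n, rfl⟩
      exact ⟨h, hh, n • c, ⟨n, rfl⟩, rfl⟩

/-! ### Symmetric Lévy measures and their support -/

namespace IsSymmetricLevyMeasure

variable {d : ℕ} {μ : Measure (Rd d)}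

theorem integrable_min (hμ : IsSymmetricLevyMeasure μ) :
    Integrable (fun z : Rd d => min (‖z‖ ^ 2) 1) μ := by
  refine ⟨by fun_prop, ?_⟩
  rw [hasFiniteIntegral_iff_ofReal (Eventually.of_forall fun z => by positivity)]
  exact hμ.lintegral_lt_top

theorem measure_norm_gt_lt_top (hμ : IsSymmetricLevyMeasure μ) {r : ℝ} (hr : 0 < r) :
    μ {z : Rd d | r < ‖z‖} < ⊤ := by
  refine (measure_mono ?_).trans_lt
    (hμ.integrable_min.measure_ge_lt_top (ε := min (r ^ 2) 1) (by positivity))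
  intro z hz
  exact min_le_min_right 1 (pow_le_pow_left₀ hr.le (le_of_lt hz) 2)

theorem measurePreserving_neg (hμ : IsSymmetricLevyMeasure μ) :
    MeasurePreserving (fun z : Rd d => -z) μ μ := by
  refine ⟨measurable_neg, Measure.ext fun B hB => ?_⟩
  rw [Measure.map_apply measurable_neg hB]
  exact (hμ.symmetric B hB).symm

theorem sigmaFinite (hμ : IsSymmetricLevyMeasure μ) : SigmaFinite μ := by
  refine ⟨⟨⟨fun n => {z : Rd d | 1 / ((n : ℝ) + 1) < ‖z‖} ∪ {0}, fun _ => trivial, fun n => ?_,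
    ?_⟩⟩⟩
  · refine (measure_union_le _ _).trans_lt ?_
    rw [hμ.zero_singleton, add_zero]
    exact hμ.measure_norm_gt_lt_top Nat.one_div_pos_of_nat
  · refine eq_univ_of_forall fun z => mem_iUnion.2 ?_
    by_cases hz : z = 0
    · exact ⟨0, Or.inr hz⟩
    · obtain ⟨n, hn⟩ := exists_nat_one_div_lt (norm_pos_iff.2 hz)
      exact ⟨n, Or.inl hn⟩

theorem ae_mem_levySupport (hμ : IsSymmetricLevyMeasure μ) : ∀ᵐ z ∂μ, z ∈ levySupport μ := by
  have h0 : ∀ᵐ z ∂μ, z ≠ 0 := by simpa [ae_iff] using hμ.zero_singleton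
  have h1 : ∀ᵐ z ∂μ, z ∈ μ.support := Measure.support_mem_ae
  filter_upwards [h0, h1] with z hz hz'
  exact ⟨hz, Metric.nhds_basis_ball.mem_measureSupport.1 hz'⟩

theorem neg_mem_levySupport (hμ : IsSymmetricLevyMeasure μ) {z : Rd d} (hz : z ∈ levySupport μ) :
    -z ∈ levySupport μ := by
  refine ⟨neg_ne_zero.2 hz.1, fun r hr => ?_⟩
  have h := hμ.symmetric _ (Metric.isOpen_ball (x := z) (ε := r)).measurableSet
  rw [neg_ball] at h
  exact h ▸ hz.2 r hr

/-- The mass of `|z|² ∧ 1` in small balls around the origin tends to zero, as `μ` does not charge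
the origin. -/
theorem exists_setIntegral_min_lt (hμ : IsSymmetricLevyMeasure μ) {ε R : ℝ} (hε : 0 < ε)
    (hR : 0 < R) :
    ∃ δ, 0 < δ ∧ δ < R ∧ ∫ z in {z : Rd d | ‖z‖ ≤ δ}, min (‖z‖ ^ 2) 1 ∂μ < ε := by
  have hm : ∀ δ : ℝ, MeasurableSet {z : Rd d | ‖z‖ ≤ δ} :=
    fun δ => measurableSet_le measurable_norm measurable_const
  have hlim : Tendsto (fun δ : ℝ => ∫ z, {z : Rd d | ‖z‖ ≤ δ}.indicator
      (fun z => min (‖z‖ ^ 2) 1) z ∂μ) (𝓝[>] 0) (𝓝 (∫ _, (0 : ℝ) ∂μ)) := by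
    refine tendsto_integral_filter_of_dominated_convergence (fun z => min (‖z‖ ^ 2) 1)
      (Eventually.of_forall fun δ => ?_) (Eventually.of_forall fun δ => Eventually.of_forall
        fun z => ?_) hμ.integrable_min (Eventually.of_forall fun z => ?_)
    · exact (Continuous.aestronglyMeasurable (by fun_prop)).indicator (hm δ)
    · refine (norm_indicator_le_norm_self _ _).trans ?_
      rw [Real.norm_of_nonneg (by positivity)]
    · by_cases hz : z = 0
      · subst hz
        refine tendsto_const_nhds.congr' (Eventually.of_forall fun r => ?_)
        simp [indicator]
      · refine tendsto_const_nhds.congr' ?_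
        filter_upwards [nhdsWithin_le_nhds (Iio_mem_nhds (norm_pos_iff.2 hz))] with δ hδ
        rw [indicator_of_notMem]
        exact not_le.2 (mem_Iio.1 hδ)
  rw [integral_zero] at hlim
  have hRlt : ∀ᶠ δ in 𝓝[>] (0 : ℝ), δ < R := nhdsWithin_le_nhds (Iio_mem_nhds hR)
  obtain ⟨δ, h1, h2, h3⟩ :=
    ((hlim.eventually_lt_const hε).and (hRlt.and self_mem_nhdsWithin)).exists
  exact ⟨δ, h3, h2, by rwa [integral_indicator (hm δ)] at h1⟩

end IsSymmetricLevyMeasure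

/-! ### The operator as an integral of second differences -/

/-- The symmetric second difference `w(x + z) + w(x - z) - 2 w(x)`. -/
def secondDifference {d : ℕ} (w : Rd d → ℝ) (x z : Rd d) : ℝ :=
  w (x + z) + w (x - z) - 2 * w x

/-- The principal value is an absolutely convergent integral of second differences. -/
theorem levyOperator_eq_integral {d : ℕ} {μ : Measure (Rd d)} (hμ : IsSymmetricLevyMeasure μ)
    {ψ : Rd d → ℝ} (hψ : ContDiff ℝ ∞ ψ) (hc : HasCompactSupport ψ) (x : Rd d) :
    levyOperator μ ψ x = (∫ z, secondDifference ψ x z ∂μ) / 2 := by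
  obtain ⟨C, hC⟩ := exists_bound_second_difference hψ hc
  have hψc := hψ.continuous
  have hmeas : ∀ r : ℝ, MeasurableSet {z : Rd d | r < ‖z‖} :=
    fun r => measurableSet_lt measurable_const measurable_norm
  obtain ⟨M, hM⟩ := hc.exists_bound_of_continuous hψc
  have hint : ∀ r : ℝ, 0 < r → ∀ s : Rd d → Rd d, Continuous s →
      IntegrableOn (fun z => ψ (s z) - ψ x) {z : Rd d | r < ‖z‖} μ := by
    intro r hr s hs
    refine Measure.integrableOn_of_bounded (M := M + M) (hμ.measure_norm_gt_lt_top hr).ne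
      (by fun_prop) (Eventually.of_forall fun z => ?_)
    exact (norm_sub_le _ _).trans (add_le_add (hM _) (hM _))
  have hsymm : ∀ r : ℝ, 0 < r → truncatedLevyOperator μ r ψ x =
      (∫ z, {z : Rd d | r < ‖z‖}.indicator (secondDifference ψ x) z ∂μ) / 2 := by
    intro r hr
    have h1 : ∫ z in {z : Rd d | r < ‖z‖}, (ψ (x - z) - ψ x) ∂μ =
        truncatedLevyOperator μ r ψ x := by
      have := hμ.measurePreserving_neg.setIntegral_preimage_emb
        (MeasurableEquiv.neg (Rd d)).measurableEmbedding
        (fun z => ψ (x + z) - ψ x) {z : Rd d | r < ‖z‖}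
      simpa [truncatedLevyOperator, sub_eq_add_neg] using this
    rw [integral_indicator (hmeas r)]
    have h2 := integral_add (hint r hr (fun z => x + z) (by fun_prop))
      (hint r hr (fun z => x - z) (by fun_prop))
    rw [h1] at h2
    have h3 : secondDifference ψ x = fun z => (ψ (x + z) - ψ x) + (ψ (x - z) - ψ x) := by
      funext z; unfold secondDifference; ring
    rw [h3, h2]
    unfold truncatedLevyOperator
    ring
  refine tendsto_nhds_unique (tendsto_truncatedLevyOperator hμ hψ hc x) ?_
  refine Tendsto.congr' (f₁ := fun r => (∫ z, {z : Rd d | r < ‖z‖}.indicator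
    (secondDifference ψ x) z ∂μ) / 2) ?_ (Tendsto.div_const ?_ 2)
  · filter_upwards [self_mem_nhdsWithin] with r hr using (hsymm r hr).symm
  · refine tendsto_integral_filter_of_dominated_convergence
      (fun z => C * min (‖z‖ ^ 2) 1) ?_ ?_ (hμ.integrable_min.const_mul _) ?_
    · refine Eventually.of_forall fun r => ?_
      exact (Continuous.aestronglyMeasurable
        (by unfold secondDifference; fun_prop)).indicator (hmeas r)
    · exact Eventually.of_forall fun r => Eventually.of_forall fun z =>
        (norm_indicator_le_norm_self _ _).trans (hC x z)
    · refine Eventually.of_forall fun z => ?_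
      by_cases hz : z = 0
      · subst hz
        have h0 : secondDifference ψ x 0 = 0 := by simp [secondDifference]; ring
        refine tendsto_const_nhds.congr' (Eventually.of_forall fun r => ?_)
        simp only [indicator_apply, h0, ite_self]
      · refine tendsto_const_nhds.congr' ?_
        filter_upwards [nhdsWithin_le_nhds (Iio_mem_nhds (norm_pos_iff.2 hz))] with r hr
        rw [indicator_of_mem]
        exact hr

/-- A function bounded by `b` that vanishes where `ψ` vanishes on the whole ball of radius `1`
has its integral controlled by `b`. -/
theorem exists_integral_abs_le {d : ℕ} {ψ : Rd d → ℝ} (hc : HasCompactSupport ψ) :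
    ∃ V : ℝ, 0 ≤ V ∧ ∀ (g : Rd d → ℝ) (b : ℝ), (∀ y, |g y| ≤ b) →
      (∀ y, (∀ h : Rd d, ‖h‖ ≤ 1 → ψ (y + h) = 0) → g y = 0) → ∫ y, |g y| ≤ b * V := by
  let K := Metric.cthickening 1 (tsupport ψ)
  have hK : IsCompact K := hc.isCompact.cthickening
  refine ⟨volume.real K, measureReal_nonneg, fun g b hb hg => ?_⟩
  have hzero : ∀ y, y ∉ K → |g y| = 0 := by
    intro y hy
    rw [hg y fun h hh => ?_, abs_zero]
    by_contra hne
    refine hy (Metric.mem_cthickening_of_dist_le y (y + h) 1 _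
      (subset_tsupport _ (Function.mem_support.2 hne)) ?_)
    simpa [dist_eq_norm] using hh
  rw [← setIntegral_eq_integral_of_forall_compl_eq_zero hzero]
  refine (le_abs_self _).trans ?_
  rw [← Real.norm_eq_abs]
  exact norm_setIntegral_le_of_norm_le_const hK.measure_lt_top
    (fun y _ => by simpa using hb y)

theorem integrable_secondDifference {d : ℕ} {ψ : Rd d → ℝ} (hψ : Continuous ψ)
    (hc : HasCompactSupport ψ) (z : Rd d) :
    Integrable (fun y => secondDifference ψ y z) := by
  have h := hψ.integrable_of_hasCompactSupport (μ := volume) hc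
  exact ((h.comp_add_right z).add (h.comp_sub_right z)).sub (h.const_mul 2)

/-- Second differences of test functions satisfy the Taylor bound in `L¹` as well. -/
theorem exists_integral_secondDifference_le {d : ℕ} {ψ : Rd d → ℝ} (hψ : ContDiff ℝ ∞ ψ)
    (hc : HasCompactSupport ψ) :
    ∃ C : ℝ, 0 ≤ C ∧ ∀ z, ∫ y, |secondDifference ψ y z| ≤ C * min (‖z‖ ^ 2) 1 := by
  obtain ⟨C, hC⟩ := exists_bound_second_difference hψ hc
  obtain ⟨V, hV, hVb⟩ := exists_integral_abs_le hc
  have hi := hψ.continuous.integrable_of_hasCompactSupport (μ := volume) hc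
  have hI : 0 ≤ ∫ y, |ψ y| := integral_nonneg fun _ => abs_nonneg _
  refine ⟨|C| * V + 4 * ∫ y, |ψ y|, by positivity, fun z => ?_⟩
  have hm : 0 ≤ min (‖z‖ ^ 2) 1 := by positivity
  rcases le_total ‖z‖ 1 with h | h
  · have h1 := hVb (fun y => secondDifference ψ y z) (|C| * min (‖z‖ ^ 2) 1)
      (fun y => (hC y z).trans (mul_le_mul_of_nonneg_right (le_abs_self C) hm)) fun y hy => by
        have h0 := hy 0 (by simp)
        have hp := hy z h
        have hn := hy (-z) (by simpa using h)
        rw [add_zero] at h0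
        rw [← sub_eq_add_neg] at hn
        simp [secondDifference, h0, hp, hn]
    refine h1.trans ?_
    have : 0 ≤ (∫ y, |ψ y|) * min (‖z‖ ^ 2) 1 := by positivity
    linarith
  · have hm1 : min (‖z‖ ^ 2) 1 = 1 := min_eq_right (one_le_pow₀ h)
    rw [hm1, mul_one]
    have ha := (hi.comp_add_right z).abs
    have hs := (hi.comp_sub_right z).abs
    have hle : ∫ y, |secondDifference ψ y z| ≤ ∫ y, ((|ψ (y + z)| + |ψ (y - z)|) + 2 * |ψ y|) := by
      refine integral_mono (integrable_secondDifference hψ.continuous hc z).abs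
        ((ha.add hs).add (hi.abs.const_mul 2)) fun y => ?_
      unfold secondDifference
      refine (abs_sub _ _).trans (add_le_add (abs_add_le _ _) ?_)
      rw [abs_mul, abs_two]
    have hsum := integral_add (ha.add hs) (hi.abs.const_mul 2)
    simp only [Pi.add_apply] at hsum
    rw [hsum, integral_add ha hs, integral_const_mul, integral_add_right_eq_self (fun y => |ψ y|) z,
      integral_sub_right_eq_self (fun y => |ψ y|) z] at hle
    have : 0 ≤ |C| * V := by positivity
    linarith

/-- Translation is Lipschitz in `L¹` on test functions. -/
theorem exists_integral_translate_sub_le {d : ℕ} {ψ : Rd d → ℝ} (hψ : ContDiff ℝ ∞ ψ)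
    (hc : HasCompactSupport ψ) :
    ∃ C : ℝ, 0 ≤ C ∧ ∀ h : Rd d, ‖h‖ ≤ 1 → ∫ y, |ψ (y - h) - ψ y| ≤ C * ‖h‖ := by
  obtain ⟨L, hL⟩ := (hψ.of_le (by norm_cast) : ContDiff ℝ 1 ψ).lipschitzWith_of_hasCompactSupport
    hc one_ne_zero
  obtain ⟨V, hV, hVb⟩ := exists_integral_abs_le hc
  refine ⟨L * V, by positivity, fun h hh => ?_⟩
  refine (hVb (fun y => ψ (y - h) - ψ y) (L * ‖h‖) (fun y => ?_) fun y hy => ?_).trans_eq (by ring)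
  · have := hL.dist_le_mul (y - h) y
    rwa [Real.dist_eq, dist_eq_norm, sub_sub_cancel_left, norm_neg] at this
  · have h0 := hy 0 (by simp)
    have hn := hy (-h) (by simpa using hh)
    rw [add_zero] at h0
    rw [← sub_eq_add_neg] at hn
    simp [h0, hn]

theorem exists_ae_bound {d : ℕ} {u : Rd d → ℝ} (hu : MemLp u (⊤ : ENNReal) volume) :
    ∃ B : ℝ, 0 ≤ B ∧ ∀ᵐ y, |u y| ≤ B := by
  refine ⟨lpNorm u ⊤ volume, lpNorm_nonneg, ?_⟩
  exact ae_le_lpNorm_exponent_top hu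

theorem abs_integral_mul_le {d : ℕ} {u g : Rd d → ℝ} {B : ℝ} (hB : ∀ᵐ y, |u y| ≤ B)
    (hg : Integrable g) : |∫ y, u y * g y| ≤ B * ∫ y, |g y| := by
  rw [← integral_const_mul, ← Real.norm_eq_abs]
  refine norm_integral_le_of_norm_le (hg.abs.const_mul B) ?_
  filter_upwards [hB] with y hy
  rw [norm_mul]
  exact mul_le_mul_of_nonneg_right hy (abs_nonneg _)

/-- Fubini's theorem for `u(y) (ψ(y + z) + ψ(y - z) - 2 ψ(y))`, with the integrability over `μ`
provided by the `L¹` Taylor bound. -/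
theorem integral_mul_levyOperator {d : ℕ} {μ : Measure (Rd d)} (hμ : IsSymmetricLevyMeasure μ)
    {u ψ : Rd d → ℝ} (hu : MemLp u (⊤ : ENNReal) volume) (hψ : ContDiff ℝ ∞ ψ)
    (hc : HasCompactSupport ψ) :
    ∫ y, u y * levyOperator μ ψ y = (∫ z, ∫ y, u y * secondDifference ψ y z ∂volume ∂μ) / 2 := by
  have := hμ.sigmaFinite
  obtain ⟨B, hB0, hB⟩ := exists_ae_bound hu
  obtain ⟨C, hC0, hC⟩ := exists_integral_secondDifference_le hψ hc
  have hψc := hψ.continuous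
  have hint : ∀ z, Integrable (fun y => u y * secondDifference ψ y z) := fun z =>
    (integrable_secondDifference hψc hc z).bdd_mul hu.aestronglyMeasurable hB
  have hmeas : AEStronglyMeasurable
      (Function.uncurry fun y z => u y * secondDifference ψ y z) (volume.prod μ) := by
    refine hu.aestronglyMeasurable.comp_fst.mul (Continuous.aestronglyMeasurable ?_)
    unfold secondDifference
    fun_prop
  have hprod : Integrable (Function.uncurry fun y z => u y * secondDifference ψ y z)
      (volume.prod μ) := by
    rw [integrable_prod_iff' hmeas]
    refine ⟨Eventually.of_forall hint, ?_⟩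
    refine (hμ.integrable_min.const_mul (B * C)).mono' hmeas.norm.prod_swap.integral_prod_right'
      (Eventually.of_forall fun z => ?_)
    rw [Real.norm_of_nonneg (integral_nonneg fun _ => norm_nonneg _), mul_assoc]
    refine le_trans ?_ (mul_le_mul_of_nonneg_left (hC z) hB0)
    rw [← integral_const_mul]
    refine integral_mono_ae (hint z).norm
      ((integrable_secondDifference hψc hc z).abs.const_mul B) ?_
    filter_upwards [hB] with y hy
    simp only [Function.uncurry, norm_mul, Real.norm_eq_abs]
    exact mul_le_mul_of_nonneg_right hy (abs_nonneg _)
  rw [← integral_integral_swap hprod, ← integral_div]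
  refine integral_congr_ae (Eventually.of_forall fun y => ?_)
  simp only [levyOperator_eq_integral hμ hψ hc, integral_const_mul]
  ring

/-! ### Bounded classical solutions are periodic along the support -/

/-- Bounded, uniformly continuous classical solutions of `L^μ[w] = 0`. The bound on the second
differences makes the integral that defines `L^μ[w]` absolutely convergent, uniformly in `x`. -/
structure IsBoundedClassicalSolution {d : ℕ} (μ : Measure (Rd d)) (w : Rd d → ℝ) : Prop where
  bounded : ∃ B : ℝ, ∀ x, |w x| ≤ B
  uniformContinuous : UniformContinuous w
  secondDifference_le : ∃ C : ℝ, ∀ x z, |secondDifference w x z| ≤ C * min (‖z‖ ^ 2) 1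
  integral_eq_zero : ∀ x, ∫ z, secondDifference w x z ∂μ = 0

namespace IsBoundedClassicalSolution

variable {d : ℕ} {μ : Measure (Rd d)} {w : Rd d → ℝ}

theorem integrable_secondDifference (hw : IsBoundedClassicalSolution μ w)
    (hμ : IsSymmetricLevyMeasure μ) (x : Rd d) : Integrable (secondDifference w x) μ := by
  obtain ⟨C, hC⟩ := hw.secondDifference_le
  have hc := hw.uniformContinuous.continuous
  refine (hμ.integrable_min.const_mul C).mono' (Continuous.aestronglyMeasurable ?_)
    (Eventually.of_forall (hC x))
  unfold secondDifference
  fun_prop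

theorem translate_sub (hw : IsBoundedClassicalSolution μ w) (hμ : IsSymmetricLevyMeasure μ)
    (h : Rd d) : IsBoundedClassicalSolution μ (fun x => w (x + h) - w x) := by
  obtain ⟨B, hB⟩ := hw.bounded
  obtain ⟨C, hC⟩ := hw.secondDifference_le
  have hsd : ∀ x z, secondDifference (fun x => w (x + h) - w x) x z =
      secondDifference w (x + h) z - secondDifference w x z := by
    intro x z
    simp only [secondDifference, add_right_comm x z h, sub_add_eq_add_sub x z h]
    ring
  refine ⟨⟨B + B, fun x => (abs_sub _ _).trans (add_le_add (hB _) (hB _))⟩, ?_,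
    ⟨C + C, fun x z => ?_⟩, fun x => ?_⟩
  · exact (hw.uniformContinuous.comp (uniformContinuous_id.add uniformContinuous_const)).sub
      hw.uniformContinuous
  · rw [hsd, add_mul]
    exact (abs_sub _ _).trans (add_le_add (hC _ _) (hC _ _))
  · simp only [hsd]
    rw [integral_sub (hw.integrable_secondDifference hμ _) (hw.integrable_secondDifference hμ _),
      hw.integral_eq_zero, hw.integral_eq_zero, sub_zero]

/-- Integration of a pointwise upper bound for the second differences of a solution. -/
theorem nonneg_of_secondDifference_le (hw : IsBoundedClassicalSolution μ w)
    (hμ : IsSymmetricLevyMeasure μ) {δ : ℝ} (hδ : 0 < δ) {A : Set (Rd d)} (hA : MeasurableSet A)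
    (hAfin : μ A ≠ ⊤) {C a b : ℝ} {x : Rd d}
    (h : ∀ z, secondDifference w x z ≤
      {z : Rd d | ‖z‖ ≤ δ}.indicator (fun z => C * min (‖z‖ ^ 2) 1) z +
        {z : Rd d | δ < ‖z‖}.indicator (fun _ => a) z - A.indicator (fun _ => b) z) :
    0 ≤ C * ∫ z in {z : Rd d | ‖z‖ ≤ δ}, min (‖z‖ ^ 2) 1 ∂μ +
      μ.real {z : Rd d | δ < ‖z‖} * a - μ.real A * b := by
  have hF : MeasurableSet {z : Rd d | δ < ‖z‖} := measurableSet_lt measurable_const measurable_norm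
  have hN : MeasurableSet {z : Rd d | ‖z‖ ≤ δ} := measurableSet_le measurable_norm measurable_const
  have i1 := (hμ.integrable_min.const_mul C).indicator hN
  have i2 : Integrable ({z : Rd d | δ < ‖z‖}.indicator fun _ : Rd d => a) μ :=
    (integrable_indicator_iff hF).2 (integrableOn_const (hμ.measure_norm_gt_lt_top hδ).ne)
  have i3 : Integrable (A.indicator fun _ : Rd d => b) μ :=
    (integrable_indicator_iff hA).2 (integrableOn_const hAfin)
  have h := integral_mono (hw.integrable_secondDifference hμ x) ((i1.add i2).sub i3) h
  rwa [hw.integral_eq_zero, integral_sub' (i1.add i2) i3, integral_add' i1 i2,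
    integral_indicator hN, integral_indicator hF, integral_indicator hA, integral_const_mul,
    setIntegral_const, setIntegral_const, smul_eq_mul, smul_eq_mul] at h

/-- Quantitative strong maximum principle: where a solution is close to an upper bound `M`, it is
still close to `M` after a translation by a point of the support, uniformly in space. Far from the
origin the second difference is at most twice the gap to `M`, near the origin it contributes
little, so a drop of size `η` on a ball of positive measure would make the integral negative. -/
theorem almost_maximum_translate (hw : IsBoundedClassicalSolution μ w)
    (hμ : IsSymmetricLevyMeasure μ) {M : ℝ} (hM : ∀ x, w x ≤ M) {z₀ : Rd d}
    (hz₀ : z₀ ∈ levySupport μ) {η : ℝ} (hη : 0 < η) :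
    ∃ γ > 0, ∀ x, M - γ < w x → M - η < w (x + z₀) := by
  obtain ⟨C, hC⟩ := hw.secondDifference_le
  have hz : 0 < ‖z₀‖ := norm_pos_iff.2 hz₀.1
  obtain ⟨r₀, hr₀, hr₀w⟩ := Metric.uniformContinuous_iff.1 hw.uniformContinuous (η / 4)
    (by positivity)
  obtain ⟨r, hr, hrr₀, hrz⟩ : ∃ r > 0, r ≤ r₀ ∧ r ≤ ‖z₀‖ / 2 :=
    ⟨min r₀ (‖z₀‖ / 2), lt_min hr₀ (half_pos hz), min_le_left _ _, min_le_right _ _⟩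
  set A := Metric.ball z₀ r
  have hA : MeasurableSet A := Metric.isOpen_ball.measurableSet
  have hball : ∀ z ∈ A, ‖z₀‖ / 2 < ‖z‖ := by
    intro z hzA
    have h1 : ‖z - z₀‖ < r := mem_ball_iff_norm.1 hzA
    have h2 := norm_sub_norm_le z₀ z
    rw [norm_sub_rev] at h2
    linarith
  have hAfin : μ A ≠ ⊤ :=
    ((measure_mono hball).trans_lt (hμ.measure_norm_gt_lt_top (half_pos hz))).ne
  have hm : 0 < μ.real A := ENNReal.toReal_pos (hz₀.2 r hr).ne' hAfin
  obtain ⟨δ, hδ, hδz, hδI⟩ := hμ.exists_setIntegral_min_lt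
    (ε := η * μ.real A / (8 * (|C| + 1))) (by positivity) (half_pos hz)
  set F := {z : Rd d | δ < ‖z‖}
  set N := {z : Rd d | ‖z‖ ≤ δ}
  have hF0 : 0 ≤ μ.real F := measureReal_nonneg
  obtain ⟨γ, hγ, hfar⟩ : ∃ γ > 0, μ.real F * (2 * γ) ≤ η * μ.real A / 4 := by
    refine ⟨η * μ.real A / (8 * (μ.real F + 1)), by positivity, ?_⟩
    rw [← mul_div_assoc, ← mul_div_assoc, div_le_div_iff₀ (by positivity) (by positivity)]
    nlinarith [mul_pos hη hm]
  have hnear : C * ∫ z in N, min (‖z‖ ^ 2) 1 ∂μ ≤ η * μ.real A / 8 := by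
    have hI : 0 ≤ ∫ z in N, min (‖z‖ ^ 2) 1 ∂μ := integral_nonneg fun z => by positivity
    rw [lt_div_iff₀ (by positivity)] at hδI
    generalize ∫ z in N, min (‖z‖ ^ 2) 1 ∂μ = I at hδI hI ⊢
    have := mul_le_mul_of_nonneg_right (le_abs_self C) hI
    linarith
  refine ⟨γ, hγ, fun x hx => ?_⟩
  by_contra! hdrop
  have hptw : ∀ z, secondDifference w x z ≤
      N.indicator (fun z => C * min (‖z‖ ^ 2) 1) z + F.indicator (fun _ => 2 * γ) z -
        A.indicator (fun _ => 3 * η / 4) z := by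
    intro z
    by_cases hzF : δ < ‖z‖
    · have h1 := hM (x + z)
      have h2 := hM (x - z)
      rw [indicator_of_notMem (show z ∉ N from not_le.2 hzF),
        indicator_of_mem (show z ∈ F from hzF)]
      by_cases hzA : z ∈ A
      · rw [indicator_of_mem hzA]
        have h3 : dist (x + z) (x + z₀) < r₀ := by
          rw [dist_add_left]
          exact (Metric.mem_ball.1 hzA).trans_le hrr₀
        have h4 := (abs_lt.1 (hr₀w h3)).2
        unfold secondDifference
        linarith
      · rw [indicator_of_notMem hzA]
        unfold secondDifference
        linarith
    · have hzA : z ∉ A := fun h => hzF (hδz.trans (hball z h))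
      rw [indicator_of_mem (show z ∈ N from not_lt.1 hzF),
        indicator_of_notMem (show z ∉ F from hzF), indicator_of_notMem hzA]
      simpa using (abs_le.1 (hC x z)).2
  have h := hw.nonneg_of_secondDifference_le hμ hδ hA hAfin hptw
  have := mul_pos hη hm
  linarith

/-- Iteration of the maximum principle along multiples of a point of the support. -/
theorem almost_maximum_translate_nsmul (hw : IsBoundedClassicalSolution μ w)
    (hμ : IsSymmetricLevyMeasure μ) {M : ℝ} (hM : ∀ x, w x ≤ M) {z₀ : Rd d}
    (hz₀ : z₀ ∈ levySupport μ) {η : ℝ} (hη : 0 < η) (n : ℕ) :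
    ∃ γ > 0, ∀ x, M - γ < w x → ∀ k ≤ n, M - η < w (x + k • z₀) := by
  induction n with
  | zero => exact ⟨η, hη, fun x hx k hk => by simpa [Nat.le_zero.1 hk] using hx⟩
  | succ n ih =>
    obtain ⟨γ, hγ, h⟩ := ih
    obtain ⟨γ', hγ', h'⟩ := hw.almost_maximum_translate hμ hM hz₀ hγ
    refine ⟨min γ' η, lt_min hγ' hη, fun x hx k hk => ?_⟩
    cases k with
    | zero => simpa using (sub_le_sub_left (min_le_right γ' η) M).trans_lt hx
    | succ k =>
      have := h _ (h' x ((sub_le_sub_left (min_le_left γ' η) M).trans_lt hx)) k (by omega)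
      rwa [add_assoc, ← succ_nsmul'] at this

/-- If the increments `v = w(· + z₀) - w` had a positive supremum, they would stay close to it along
arbitrarily many steps `z₀`, and `w` would be unbounded. -/
theorem translate_le (hw : IsBoundedClassicalSolution μ w) (hμ : IsSymmetricLevyMeasure μ)
    {z₀ : Rd d} (hz₀ : z₀ ∈ levySupport μ) (x : Rd d) : w (x + z₀) ≤ w x := by
  by_contra! hx
  have hv := hw.translate_sub hμ z₀
  set v : Rd d → ℝ := fun x => w (x + z₀) - w x with hvdef
  obtain ⟨B, hB⟩ := hw.bounded
  obtain ⟨B', hB'⟩ := hv.bounded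
  have hbdd : BddAbove (range v) := ⟨B', by rintro _ ⟨y, rfl⟩; exact (abs_le.1 (hB' y)).2⟩
  set M := ⨆ y, v y with hMdef
  have hM : ∀ y, v y ≤ M := le_ciSup hbdd
  have hM0 : 0 < M := (sub_pos.2 hx).trans_le (hM x)
  obtain ⟨n, hn⟩ := exists_nat_gt (2 * B / (M / 2))
  obtain ⟨γ, hγ, h⟩ := hv.almost_maximum_translate_nsmul hμ hM hz₀ (half_pos hM0) n
  obtain ⟨y, hy⟩ := exists_lt_of_lt_ciSup (sub_lt_self M hγ)
  have hsum : ∑ k ∈ Finset.range n, v (y + k • z₀) = w (y + n • z₀) - w y := by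
    have := Finset.sum_range_sub (fun k : ℕ => w (y + k • z₀)) n
    simpa only [hvdef, add_assoc, ← succ_nsmul, zero_smul, add_zero] using this
  have hlow : n * (M / 2) ≤ ∑ k ∈ Finset.range n, v (y + k • z₀) := by
    have := Finset.card_nsmul_le_sum (Finset.range n) (fun k => v (y + k • z₀)) (M / 2)
      fun k hk => by linarith [h y hy k (Finset.mem_range.1 hk).le]
    simpa using this
  have h1 := (div_lt_iff₀ (half_pos hM0)).1 hn
  have h2 := (abs_le.1 (hB (y + n • z₀))).2
  have h3 := (abs_le.1 (hB y)).1
  linarith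

theorem periodic (hw : IsBoundedClassicalSolution μ w) (hμ : IsSymmetricLevyMeasure μ)
    {z₀ : Rd d} (hz₀ : z₀ ∈ levySupport μ) (x : Rd d) : w (x + z₀) = w x := by
  refine le_antisymm (hw.translate_le hμ hz₀ x) ?_
  simpa using hw.translate_le hμ (hμ.neg_mem_levySupport hz₀) (x + z₀)

/-- The periods of a solution form a closed subgroup, which is everything when the support
generates a dense subgroup. -/
theorem eq_apply_zero (hw : IsBoundedClassicalSolution μ w) (hμ : IsSymmetricLevyMeasure μ)
    (hd : Dense (AddSubgroup.closure (levySupport μ) : Set (Rd d))) (x : Rd d) : w x = w 0 := by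
  have hc := hw.uniformContinuous.continuous
  have hper : ∀ g ∈ AddSubgroup.closure (levySupport μ), ∀ x, w (x + g) = w x := by
    intro g hg
    induction hg using AddSubgroup.closure_induction with
    | mem z hz => exact hw.periodic hμ hz
    | zero => simp
    | add a b _ _ ha hb => intro x; rw [← add_assoc, hb, ha]
    | neg a _ ha => intro x; simpa using (ha (x + -a)).symm
  have hclosed : IsClosed {g | w g = w 0} := isClosed_eq hc continuous_const
  have hsub : closure (AddSubgroup.closure (levySupport μ) : Set (Rd d)) ⊆ {g | w g = w 0} :=
    closure_minimal (fun g hg => by simpa using hper g hg 0) hclosed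
  exact hsub (hd.closure_eq ▸ mem_univ x)

end IsBoundedClassicalSolution

/-! ### Regularization of distributional solutions -/

theorem integral_add_sub_two_mul {d : ℕ} {f g h : Rd d → ℝ} (hf : Integrable f)
    (hg : Integrable g) (hh : Integrable h) :
    ∫ y, (f y + g y - 2 * h y) = (∫ y, f y) + (∫ y, g y) - 2 * ∫ y, h y := by
  rw [← integral_add hf hg, ← integral_const_mul]
  exact integral_sub (hf.add hg) (hh.const_mul 2)

/-- Mollification turns bounded distributional solutions into classical ones. -/
theorem IsDistributionalSolution.isBoundedClassicalSolution {d : ℕ} {μ : Measure (Rd d)}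
    (hμ : IsSymmetricLevyMeasure μ) {u : Rd d → ℝ} (hu : MemLp u (⊤ : ENNReal) volume)
    (hsol : IsDistributionalSolution μ u) {ψ : Rd d → ℝ} (hψ : ContDiff ℝ ∞ ψ)
    (hc : HasCompactSupport ψ) :
    IsBoundedClassicalSolution μ (fun x => ∫ y, u y * ψ (y - x)) := by
  obtain ⟨B, hB0, hB⟩ := exists_ae_bound hu
  have hi : ∀ x, Integrable (fun y => ψ (y - x)) := fun x =>
    (hψ.continuous.integrable_of_hasCompactSupport (μ := volume) hc).comp_sub_right x
  have hui : ∀ x, Integrable (fun y => u y * ψ (y - x)) := fun x =>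
    (hi x).bdd_mul hu.aestronglyMeasurable hB
  have hsd : ∀ x z, secondDifference (fun x => ∫ y, u y * ψ (y - x)) x z =
      ∫ y, u y * secondDifference ψ (y - x) z := by
    intro x z
    have e : ∀ y, u y * secondDifference ψ (y - x) z =
        (u y * ψ (y - (x + z)) + u y * ψ (y - (x - z))) - 2 * (u y * ψ (y - x)) := by
      intro y
      have e1 : y - x + z = y - (x - z) := by abel
      have e2 : y - x - z = y - (x + z) := by abel
      rw [secondDifference, e1, e2]
      ring
    simp only [e]
    rw [integral_add_sub_two_mul (hui _) (hui _) (hui x), secondDifference]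
  refine ⟨⟨B * ∫ y, |ψ y|, fun x => ?_⟩, ?_, ?_, fun x => ?_⟩
  · rw [← integral_sub_right_eq_self (fun y => |ψ y|) x]
    exact abs_integral_mul_le hB (hi x)
  · obtain ⟨C, hC0, hC⟩ := exists_integral_translate_sub_le hψ hc
    rw [Metric.uniformContinuous_iff]
    intro ε hε
    refine ⟨min 1 (ε / (B * C + 1)), by positivity, fun {x x'} hxx => ?_⟩
    rw [dist_eq_norm] at hxx
    have h1 : ‖x - x'‖ ≤ 1 := (hxx.trans_le (min_le_left _ _)).le
    have h2 := hxx.trans_le (min_le_right _ _)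
    rw [lt_div_iff₀ (by positivity)] at h2
    rw [Real.dist_eq, ← integral_sub (hui x) (hui x')]
    simp only [← mul_sub]
    have hsh : ∫ y, |ψ (y - x) - ψ (y - x')| = ∫ y, |ψ (y - (x - x')) - ψ y| := by
      rw [← integral_sub_right_eq_self (fun y => |ψ (y - (x - x')) - ψ y|) x']
      simp
    calc |∫ y, u y * (ψ (y - x) - ψ (y - x'))|
        ≤ B * ∫ y, |ψ (y - x) - ψ (y - x')| := abs_integral_mul_le hB ((hi x).sub (hi x'))
      _ ≤ B * (C * ‖x - x'‖) := by rw [hsh]; gcongr; exact hC _ h1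
      _ < ε := by nlinarith [norm_nonneg (x - x')]
  · obtain ⟨C, hC0, hC⟩ := exists_integral_secondDifference_le hψ hc
    refine ⟨B * C, fun x z => ?_⟩
    rw [hsd, mul_assoc]
    refine (abs_integral_mul_le hB
      ((_root_.integrable_secondDifference hψ.continuous hc z).comp_sub_right x)).trans ?_
    rw [integral_sub_right_eq_self (fun y => |secondDifference ψ y z|) x]
    exact mul_le_mul_of_nonneg_left (hC z) hB0
  · have hψ' : ContDiff ℝ ∞ fun y => ψ (y - x) := hψ.comp (contDiff_id.sub contDiff_const)
    have hc' : HasCompactSupport fun y => ψ (y - x) := by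
      simpa [Function.comp_def, sub_eq_add_neg] using
        hc.comp_homeomorph (Homeomorph.addRight (-x))
    have h := hsol _ hψ' hc'
    rw [integral_mul_levyOperator hμ hu hψ' hc'] at h
    have e : ∀ y z, secondDifference (fun y => ψ (y - x)) y z = secondDifference ψ (y - x) z := by
      intro y z
      have e1 : y + z - x = y - x + z := by abel
      have e2 : y - z - x = y - x - z := by abel
      simp only [secondDifference, e1, e2]
    simp only [e] at h
    simp only [hsd]
    linarith

/-- Liouville property: all mollifications are constant, and they converge almost everywhere. -/
theorem exists_ae_eq_const_of_dense {d : ℕ} {μ : Measure (Rd d)} (hμ : IsSymmetricLevyMeasure μ)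
    (hd : Dense (AddSubgroup.closure (levySupport μ) : Set (Rd d))) {u : Rd d → ℝ}
    (hu : MemLp u (⊤ : ENNReal) volume) (hsol : IsDistributionalSolution μ u) :
    ∃ c : ℝ, u =ᵐ[volume] fun _ => c := by
  let φ : ℕ → ContDiffBump (0 : Rd d) := fun n =>
    ⟨1 / ((n : ℝ) + 1), 2 * (1 / ((n : ℝ) + 1)), Nat.one_div_pos_of_nat,
      lt_two_mul_self Nat.one_div_pos_of_nat⟩
  have hφ : Tendsto (fun n => (φ n).rOut) atTop (𝓝 0) := by
    simpa [φ] using (tendsto_one_div_add_atTop_nhds_zero_nat (𝕜 := ℝ)).const_mul 2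
  have hconv := ContDiffBump.ae_convolution_tendsto_right_of_locallyIntegrable (μ := volume) hφ
    (K := 2) (Eventually.of_forall fun n => le_rfl) (hu.locallyIntegrable le_top)
  let c : ℕ → ℝ := fun n => ∫ y, u y * (φ n).normed volume y
  have hlim : ∀ᵐ x, Tendsto c atTop (𝓝 (u x)) := by
    filter_upwards [hconv] with x hx
    refine hx.congr fun n => ?_
    have hw := (hsol.isBoundedClassicalSolution hμ hu ((φ n).contDiff_normed)
      ((φ n).hasCompactSupport_normed (μ := volume))).eq_apply_zero hμ hd x
    simp only [sub_zero] at hw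
    change _ = ∫ y, u y * (φ n).normed volume y
    rw [← hw, convolution_eq_swap]
    refine integral_congr_ae (Eventually.of_forall fun y => ?_)
    simp only [ContinuousLinearMap.lsmul_apply, smul_eq_mul]
    rw [← (φ n).normed_neg, neg_sub, mul_comm]
  obtain ⟨x₀, hx₀⟩ := hlim.exists
  exact ⟨u x₀, hlim.mono fun x hx => tendsto_nhds_unique hx hx₀⟩

/-! ### Periodic counterexamples -/

/-- A bounded function that is periodic along the support is a distributional solution. -/
theorem isDistributionalSolution_of_periodic {d : ℕ} {μ : Measure (Rd d)}
    (hμ : IsSymmetricLevyMeasure μ) {u : Rd d → ℝ} (hu : MemLp u (⊤ : ENNReal) volume)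
    (hper : ∀ z ∈ levySupport μ, ∀ x, u (x + z) = u x) : IsDistributionalSolution μ u := by
  intro ψ hψ hc
  obtain ⟨B, hB0, hB⟩ := exists_ae_bound hu
  have hi := hψ.continuous.integrable_of_hasCompactSupport (μ := volume) hc
  have hui : ∀ {g : Rd d → ℝ}, Integrable g → Integrable (fun y => u y * g y) := fun hg =>
    hg.bdd_mul hu.aestronglyMeasurable hB
  have htr : ∀ z ∈ levySupport μ, ∫ y, u y * ψ (y + z) = ∫ y, u y * ψ y := by
    intro z hz
    rw [← integral_add_right_eq_self (fun y => u y * ψ y) z]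
    simp only [hper z hz]
  rw [integral_mul_levyOperator hμ hu hψ hc, integral_eq_zero_of_ae, zero_div]
  filter_upwards [hμ.ae_mem_levySupport] with z hz
  have e : ∀ y, u y * secondDifference ψ y z =
      (u y * ψ (y + z) + u y * ψ (y - z)) - 2 * (u y * ψ y) := by
    intro y; unfold secondDifference; ring
  have hneg := htr _ (hμ.neg_mem_levySupport hz)
  simp only [← sub_eq_add_neg] at hneg
  simp only [e]
  rw [integral_add_sub_two_mul (hui (hi.comp_add_right z)) (hui (hi.comp_sub_right z)) (hui hi),
    htr z hz, hneg, Pi.zero_apply]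
  ring

/-- If a nonzero functional `f` has integer values on the support, then `cos (2π f)` violates the
Liouville property. -/
theorem exists_nonconstant_solution {d : ℕ} {μ : Measure (Rd d)} (hμ : IsSymmetricLevyMeasure μ)
    {f : Rd d →ₗ[ℝ] ℝ} (hf : f ≠ 0) (hfμ : ∀ z ∈ levySupport μ, ∃ n : ℤ, f z = n) :
    ∃ u : Rd d → ℝ, MemLp u (⊤ : ENNReal) volume ∧ IsDistributionalSolution μ u ∧
      ¬∃ c : ℝ, u =ᵐ[volume] fun _ => c := by
  have hfc : Continuous f := f.continuous_of_finiteDimensional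
  have hcont : Continuous fun x => Real.cos (2 * Real.pi * f x) := by fun_prop
  have hmem : MemLp (fun x => Real.cos (2 * Real.pi * f x)) (⊤ : ENNReal) volume :=
    memLp_top_of_bound hcont.aestronglyMeasurable 1
      (Eventually.of_forall fun x => Real.abs_cos_le_one _)
  refine ⟨_, hmem, isDistributionalSolution_of_periodic hμ hmem fun z hz x => ?_, ?_⟩
  · obtain ⟨n, hn⟩ := hfμ z hz
    rw [map_add, hn, mul_add, mul_comm (2 * Real.pi) (n : ℝ), Real.cos_add_int_mul_two_pi]
  · rintro ⟨c, hc⟩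
    have heq := hcont.ae_eq_iff_eq volume continuous_const |>.1 hc
    obtain ⟨x, hx⟩ := LinearMap.surjective hf (1 / 2)
    have h0 := congrFun heq 0
    have h1 := congrFun heq x
    simp only [map_zero, mul_zero, Real.cos_zero] at h0
    rw [hx, mul_one_div, mul_div_cancel_left₀ _ two_ne_zero, Real.cos_pi] at h1
    linarith

/-! ### The equivalences -/

theorem theorem4p7 (d : ℕ) (hd : 1 ≤ d) (μ : Measure (Rd d)) (hμ : IsSymmetricLevyMeasure μ) :
    List.TFAE
      [ -- bounded distributional solutions are (almost everywhere) constant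
        ∀ u : Rd d → ℝ, MemLp u (⊤ : ENNReal) volume → IsDistributionalSolution μ u →
          ∃ c : ℝ, u =ᵐ[volume] fun _ => c,
        -- the subgroup generated by the support is dense
        Dense (AddSubgroup.closure (levySupport μ) : Set (Rd d)),
        -- the support lies in no `V ⊕ Λ`
        ∀ (V : Submodule ℝ (Rd d)) (Λ : AddSubgroup (Rd d)),
          Module.finrank ℝ V ≤ d - 1 → IsRelativeLattice Λ →
          V ⊓ Submodule.span ℝ (Λ : Set (Rd d)) = ⊥ →
          ¬ levySupport μ ⊆ (V : Set (Rd d)) + (Λ : Set (Rd d)),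
        -- the support lies in no `H + c ℤ`
        ∀ (H : Submodule ℝ (Rd d)) (c : Rd d), Module.finrank ℝ H = d - 1 →
          ¬ levySupport μ ⊆ {z | ∃ h ∈ H, ∃ n : ℤ, z = h + n • c} ] := by
  -- The negations of all four statements are equivalent to the existence of a nonzero functional
  -- with integer values on the support.
  tfae_have 1 → 4 := by
    intro h1 H c hH hsub
    obtain ⟨Λ, hΛ, hHΛ, hle⟩ := exists_relativeLattice_of_hyperplane H c
    have hHtop : H ≠ ⊤ := by
      rintro rfl
      rw [finrank_top, finrank_euclideanSpace_fin] at hH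
      omega
    obtain ⟨f, hf, hfint⟩ := exists_integer_functional hHtop hΛ hHΛ
    obtain ⟨u, hu, hsol, hnc⟩ := exists_nonconstant_solution hμ hf
      fun z hz => hfint z (hle (hsub hz))
    exact hnc (h1 u hu hsol)
  tfae_have 4 → 3 := by
    intro h4 V Λ hV hΛ hVΛ hsub
    have hVtop : V ≠ ⊤ := by
      rintro rfl
      rw [finrank_top, finrank_euclideanSpace_fin] at hV
      omega
    obtain ⟨f, hf, hfint⟩ := exists_integer_functional hVtop hΛ hVΛ
    obtain ⟨H, c, hH, hle⟩ := exists_hyperplane_of_integer_functional hf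
    exact h4 H c hH fun z hz => hle (hfint z (hsub hz))
  tfae_have 3 → 2 := by
    intro h3
    obtain ⟨V, Λ, hΛ, hVΛ, hG⟩ := exists_eq_submodule_add_relativeLattice
      (AddSubgroup.isClosed_topologicalClosure (AddSubgroup.closure (levySupport μ)))
    have hsub : levySupport μ ⊆ (V : Set (Rd d)) + (Λ : Set (Rd d)) := by
      rw [← hG]
      exact AddSubgroup.subset_closure.trans (AddSubgroup.le_topologicalClosure _)
    have hVtop : V = ⊤ := by
      by_contra hne
      refine h3 V Λ ?_ hΛ hVΛ hsub
      have := Submodule.finrank_lt hne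
      rw [finrank_euclideanSpace_fin] at this
      omega
    rw [dense_iff_closure_eq, ← AddSubgroup.topologicalClosure_coe, hG, hVtop]
    exact eq_univ_of_forall fun x => ⟨x, trivial, 0, Λ.zero_mem, add_zero x⟩
  tfae_have 2 → 1 := fun h2 u hu hsol => exists_ae_eq_const_of_dense hμ h2 hu hsol
  tfae_finish
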